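/- Let $m,n\ge 1$ be integers and let $A,B\in\mathbb{R}_+^{m\times n}$ be (entrywise) nonnegative matrices. For $0\ne x\in\mathbb{R}^n_+$ put \[ r(A,B,x)=\inf\{t\in[0,\infty):\ Ax\le tBx\}\in[0,\infty],\qquad \rho(A,B)=\inf\{r(A,B,x):\ x>0\}, \] where inequalities between vectors are coordinatewise, $x>0$ means that all coordinates of $x$ are positive, and $\inf\emptyset=\infty$. A vector $y\in\mathbb{R}^n_+\setminus\{0\}$ is \emph{optimal} if $r(A,B,y)=\rho(A,B)$ and there are vectors $y_k>0$ ($k\in\mathbb{N}$) with $y_k\to y$ and $r(A,B,y_k)\to\rho(A,B)$. It is \emph{minimal optimal} if it is optimal and no optimal vector has a support strictly contained in $\operatorname{supp} y$. It is a \emph{GPF-vector} (generalized Perron--Frobenius vector) if $\rho(A,B)<\infty$ and $Ay=\rho(A,B)\,By$. Let $\Pi_n$ be the set of probability vectors in $\mathbb{R}^n$. The pair $(A,B)$ is a \emph{WN-pair} if $n\ge m$, $B$ has no zero row, and each column of $B$ has exactly one positive entry. For $K\subseteq\{1,\dots,n\}$ with $|K|=m$ let $A[[m],K]$, $B[[m],K]$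 be the $m\times m$ submatrices formed by the columns with index in $K$, and let $\mathcal{M}(B)$ be the set of those $K$ for which $B[[m],K]$ is monomial, that is, a permutation matrix times a diagonal matrix with positive diagonal. For $K\in\mathcal{M}(B)$ put $C_K=B[[m],K]^{-1}A[[m],K]$. The WN-pair is \emph{$S$-irreducible} if for every $K\in\mathcal{M}(B)$ the matrix $C_K$ is irreducible, that is, the digraph on $\{1,\dots,m\}$ with an edge $(i,j)$ whenever $(C_K)_{ij}>0$ is strongly connected (a digraph with one vertex always is). Let $\rho(C)$ denote the spectral radius of a square matrix $C$. \textbf{Theorem.} Let $A,B\in\mathbb{R}^{m\times n}_+$ be a WN-pair. Then: \begin{enumerate} \item $\mathcal{M}(B)\neq\emptyset$ and $\rho(A,B)=\min\{\rho(C_K):\ K\in\mathcal{M}(B)\}$. \item For each $K\in\mathcal{M}(B)$ with $\rho(A,B)=\rho(C_K)$ there is an optimal vector $y\in\Pi_n$ such that $\operatorname{supp} y\subseteq K$ and $y$ is a GPF-vector. \item If the pair is $S$-irreducible, then for each such $K$, every optimal GPF-vector $y\in\Pi_n$ with $\operatorname{supp} y\subseteq K$ is minimal optimal. \end{enumerate}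 -/

import Mathlib

open scoped NNReal ENNReal Topology Matrix

noncomputable section

namespace CollatzWielandt

variable {m n : ℕ}

/-- `r(A, B, x) = inf {t ≥ 0 : A x ≤ t B x} ∈ [0, ∞]`, with the coordinatewise order
and `inf ∅ = ∞`. -/
def ratio (A B : Matrix (Fin m) (Fin n) ℝ) (x : Fin n → ℝ) : ℝ≥0∞ :=
  ⨅ (t : ℝ≥0) (_ : A *ᵥ x ≤ (t : ℝ) • (B *ᵥ x)), (t : ℝ≥0∞)

/-- The Collatz-Wielandt quotient `ρ(A, B) = inf {r(A, B, x) : x > 0} ∈ [0, ∞]`, the infimum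
being over the vectors all of whose coordinates are positive. -/
def quotient (A B : Matrix (Fin m) (Fin n) ℝ) : ℝ≥0∞ :=
  ⨅ (x : Fin n → ℝ) (_ : ∀ j, 0 < x j), ratio A B x

/-- A nonzero nonnegative vector `y` is optimal if `r(A, B, y) = ρ(A, B)` and `y` is the limit of
positive vectors `u k` with `r(A, B, u k) → ρ(A, B)`. -/
structure IsOptimal (A B : Matrix (Fin m) (Fin n) ℝ) (y : Fin n → ℝ) : Prop where
  nonneg : ∀ j, 0 ≤ y j
  ne_zero : y ≠ 0
  ratio_eq : ratio A B y = quotient A B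
  exists_seq : ∃ u : ℕ → Fin n → ℝ, (∀ k j, 0 < u k j) ∧
    Filter.Tendsto u Filter.atTop (𝓝 y) ∧
    Filter.Tendsto (fun k => ratio A B (u k)) Filter.atTop (𝓝 (quotient A B))

/-- An optimal vector such that no optimal vector has strictly smaller support. -/
structure IsMinimalOptimal (A B : Matrix (Fin m) (Fin n) ℝ) (y : Fin n → ℝ) : Prop where
  optimal : IsOptimal A B y
  minimal : ¬ ∃ z : Fin n → ℝ, IsOptimal A B z ∧ Function.support z ⊂ Function.support y

/-- A generalized Perron-Frobenius vector: a nonzero nonnegative `y` with `A y = ρ(A, B) B y`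
(in particular `ρ(A, B)` is finite). -/
structure IsGPFVector (A B : Matrix (Fin m) (Fin n) ℝ) (y : Fin n → ℝ) : Prop where
  nonneg : ∀ j, 0 ≤ y j
  ne_zero : y ≠ 0
  finite : quotient A B ≠ ∞
  eigen : A *ᵥ y = (quotient A B).toReal • (B *ᵥ y)

/-- Wireless network pairs: `A, B ≥ 0`, `n ≥ m`, `B` has no zero row, and each column of `B` has
exactly one positive entry. -/
structure IsWNPair (A B : Matrix (Fin m) (Fin n) ℝ) : Prop where
  nonneg_left : ∀ i j, 0 ≤ A i j
  nonneg_right : ∀ i j, 0 ≤ B i j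
  le : m ≤ n
  row_ne_zero : ∀ i, ∃ j, B i j ≠ 0
  column : ∀ j, ∃! i, 0 < B i j

/-- `F[[m], K]`: the square matrix formed by the columns of `F` with index in the `m`-element set
`K`, in increasing order. -/
def columns (F : Matrix (Fin m) (Fin n) ℝ) (K : Finset (Fin n)) (hK : K.card = m) :
    Matrix (Fin m) (Fin m) ℝ :=
  F.submatrix id (K.orderEmbOfFin hK)

/-- A monomial matrix: `P D` with `P` a permutation matrix and `D` diagonal with positive
diagonal entries. -/
def IsMonomial (M : Matrix (Fin m) (Fin m) ℝ) : Prop :=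
  ∃ (σ : Equiv.Perm (Fin m)) (d : Fin m → ℝ),
    (∀ i, 0 < d i) ∧ M = σ.permMatrix ℝ * Matrix.diagonal d

/-- The matrix `B[[m], K]⁻¹ A[[m], K]`. -/
def reduced (A B : Matrix (Fin m) (Fin n) ℝ) (K : Finset (Fin n)) (hK : K.card = m) :
    Matrix (Fin m) (Fin m) ℝ :=
  (columns B K hK)⁻¹ * columns A K hK

/-- The spectral radius of a real square matrix: the largest modulus of its complex eigenvalues. -/
def radius (C : Matrix (Fin m) (Fin m) ℝ) : ℝ≥0∞ :=
  spectralRadius ℂ (C.map (algebraMap ℝ ℂ))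

/-- A nonnegative square matrix is irreducible if its digraph, with an edge `i → j` whenever
`0 < C i j`, is strongly connected. Paths may be empty, so every nonnegative `1 × 1` matrix is
irreducible. -/
def IsIrred (C : Matrix (Fin m) (Fin m) ℝ) : Prop :=
  @Quiver.IsStronglyConnected (Fin m) C.toQuiver

/-- `S`-irreducibility: `B[[m], K]⁻¹ A[[m], K]` is irreducible for every `m`-element set `K` of
columns for which `B[[m], K]` is monomial. -/
def IsSIrreducible (A B : Matrix (Fin m) (Fin n) ℝ) : Prop :=
  ∀ (K : Finset (Fin n)) (hK : K.card = m),
    IsMonomial (columns B K hK) → IsIrred (reduced A B K hK)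

end CollatzWielandt

end

noncomputable section

namespace CollatzWielandt

variable {m n : ℕ}

open Filter

/-! Upper bound: if `K` is monomial and `t` exceeds the spectral radius of `C_K`, the resolvent
yields `w > 0` with `C_K w < t w`. Extended by zero, `w` satisfies `A y < t B y` strictly in every
row, so a small multiple of the all-ones vector makes `y` positive without loss
(`IsWNPair.quotient_le_radius`).

Lower bound: if `x > 0`, `A x ≤ t B x` and `t < t'`, then `(t' B - A) x > 0`. Carathéodory replaces
`x` by some `z ≥ 0` with the same image and at most `m` nonzero entries. Then `B z > 0`, and as a
column of `B` serves only one row, the support of `z` is a monomial `K` with `C_K z ≤ t' z` on it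
(`IsWNPair.exists_radius_le`). There are finitely many `K`, so the minimum is attained.

A Perron vector of a minimizing `C_K`, extended by zero, is a GPF-vector, and every GPF-vector is
optimal. If `C_K` is irreducible, every optimal vector supported in `K` has support exactly `K`,
whence minimality. -/

lemma mulVec_nonneg {F : Matrix (Fin m) (Fin n) ℝ} (hF : ∀ i j, 0 ≤ F i j) {x : Fin n → ℝ}
    (hx : ∀ j, 0 ≤ x j) (i : Fin m) : 0 ≤ (F *ᵥ x) i := by
  rw [Matrix.mulVec, dotProduct]
  exact Finset.sum_nonneg fun j _ => mul_nonneg (hF i j) (hx j)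

lemma mulVec_le_mulVec {F : Matrix (Fin m) (Fin n) ℝ} (hF : ∀ i j, 0 ≤ F i j)
    {x y : Fin n → ℝ} (hxy : ∀ j, x j ≤ y j) (i : Fin m) : (F *ᵥ x) i ≤ (F *ᵥ y) i := by
  rw [Matrix.mulVec, dotProduct, Matrix.mulVec, dotProduct]
  exact Finset.sum_le_sum fun j _ => mul_le_mul_of_nonneg_left (hxy j) (hF i j)

/-! ### Perron–Frobenius theory for nonnegative matrices -/

section PerronFrobenius

attribute [local instance] Matrix.linftyOpNormedRing Matrix.linftyOpNormedAlgebra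

lemma exists_eigenvector_of_mem_spectrum {M : Matrix (Fin m) (Fin m) ℂ} {c : ℂ}
    (hc : c ∈ spectrum ℂ M) : ∃ v : Fin m → ℂ, v ≠ 0 ∧ M *ᵥ v = c • v := by
  rw [← Matrix.spectrum_toLin', ← Module.End.hasEigenvalue_iff_mem_spectrum] at hc
  obtain ⟨v, hv⟩ := hc.exists_hasEigenvector
  exact ⟨v, hv.2, by simpa using hv.apply_eq_smul⟩

lemma norm_mul_le_mulVec_norm {C : Matrix (Fin m) (Fin m) ℝ} (hC : ∀ i j, 0 ≤ C i j)
    {c : ℂ} {v : Fin m → ℂ} (hv : C.map (algebraMap ℝ ℂ) *ᵥ v = c • v) (i : Fin m) :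
    ‖c‖ * ‖v i‖ ≤ (C *ᵥ fun j => ‖v j‖) i := by
  have h := congrFun hv i
  simp only [Matrix.mulVec, dotProduct, Pi.smul_apply, smul_eq_mul, Matrix.map_apply] at h ⊢
  rw [← norm_mul, ← h]
  refine (norm_sum_le _ _).trans (Finset.sum_le_sum fun j _ => ?_)
  simp [abs_of_nonneg (hC i j)]

lemma radius_ne_top (C : Matrix (Fin m) (Fin m) ℝ) : radius C ≠ ∞ := by
  rcases isEmpty_or_nonempty (Fin m) with h | h
  -- For `m = 0` the spectrum is empty and the supremum is `0`.
  · have : Subsingleton (Matrix (Fin m) (Fin m) ℂ) := inferInstance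
    simp [radius, spectralRadius, spectrum.of_subsingleton]
  · exact ((spectrum.spectralRadius_le_nnnorm (𝕜 := ℂ) (C.map (algebraMap ℝ ℂ))).trans_lt
      ENNReal.coe_lt_top).ne

/-- Gelfand's formula gives `‖C ^ k‖ ≤ r ^ k` eventually, for any `r` strictly between the radius
and `t`. -/
lemma summable_geometric_of_radius_lt {C : Matrix (Fin m) (Fin m) ℝ} {t : ℝ≥0}
    (ht : radius C < t) : Summable fun k : ℕ => ((t : ℝ)⁻¹ • C) ^ k := by
  obtain ⟨r, hr, hrt⟩ := ENNReal.lt_iff_exists_nnreal_btwn.1 ht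
  have hrt' : r < t := by exact_mod_cast hrt
  have ht0 : 0 < t := zero_le.trans_lt hrt'
  have hlim := spectrum.pow_nnnorm_pow_one_div_tendsto_nhds_spectralRadius
    (C.map (algebraMap ℝ ℂ))
  have hev := hlim.eventually (gt_mem_nhds hr)
  refine Summable.of_norm_bounded_eventually_nat (g := fun k : ℕ => ((r : ℝ) / t) ^ k)
    (summable_geometric_of_lt_one (by positivity) ((div_lt_one (by exact_mod_cast ht0)).2
      (by exact_mod_cast hrt'))) ?_
  filter_upwards [hev, eventually_gt_atTop 0] with k hk hk0
  have hnorm : ‖C ^ k‖₊ ≤ r ^ k := by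
    have h1 : ‖C ^ k‖₊ = ‖(C.map (algebraMap ℝ ℂ)) ^ k‖₊ := by
      rw [← Matrix.map_pow]
      simp [Matrix.linfty_opNNNorm_def]
    rw [h1]
    have h2 := ENNReal.rpow_le_rpow hk.le (Nat.cast_nonneg (α := ℝ) k)
    rw [← ENNReal.rpow_mul, one_div, inv_mul_cancel₀ (by positivity), ENNReal.rpow_one,
      ENNReal.rpow_natCast] at h2
    exact_mod_cast h2
  have hnorm' : ‖C ^ k‖ ≤ (r : ℝ) ^ k := by exact_mod_cast hnorm
  rw [smul_pow, norm_smul, norm_pow, norm_inv, Real.norm_of_nonneg t.coe_nonneg, div_pow, inv_pow,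
    div_eq_inv_mul]
  gcongr

/-- The resolvent is the Neumann series, whose terms are nonnegative. -/
lemma exists_nonneg_resolvent {C : Matrix (Fin m) (Fin m) ℝ} (hC : ∀ i j, 0 ≤ C i j) {t : ℝ≥0}
    (ht : radius C < t) : ∃ R : Matrix (Fin m) (Fin m) ℝ, (∀ i j, 0 ≤ R i j) ∧
      ((t : ℝ) • 1 - C) * R = 1 ∧ R * ((t : ℝ) • 1 - C) = 1 := by
  have ht0 : (t : ℝ) ≠ 0 := by
    have : (0 : ℝ≥0∞) < t := zero_le.trans_lt ht
    have : 0 < t := by exact_mod_cast this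
    exact_mod_cast this.ne'
  set X := (t : ℝ)⁻¹ • C with hX
  have hs := summable_geometric_of_radius_lt ht
  have hXC : (t : ℝ) • 1 - C = (t : ℝ) • (1 - X) := by
    rw [hX, smul_sub, smul_smul, mul_inv_cancel₀ ht0, one_smul]
  have hpow : ∀ k i j, 0 ≤ (X ^ k) i j := by
    intro k
    induction k with
    | zero => intro i j; rw [pow_zero, Matrix.one_apply]; split_ifs <;> norm_num
    | succ k ih =>
      intro i j
      rw [pow_succ, Matrix.mul_apply]
      exact Finset.sum_nonneg fun l _ => mul_nonneg (ih i l)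
        (mul_nonneg (inv_nonneg.2 t.2) (hC l j))
  have hmul : (1 - X) * ∑' k, X ^ k = 1 := by
    have h1 := hs.tsum_eq_zero_add
    have h2 : ∑' k, X ^ (k + 1) = X * ∑' k, X ^ k := by
      rw [← hs.tsum_mul_left]
      simp_rw [pow_succ', ← hX]
    rw [h2, pow_zero] at h1
    rw [sub_mul, one_mul]
    nth_rewrite 1 [h1]
    abel
  have hR : ((t : ℝ) • 1 - C) * ((t : ℝ)⁻¹ • ∑' k, X ^ k) = 1 := by
    rw [hXC, smul_mul_smul_comm, hmul, mul_inv_cancel₀ ht0, one_smul]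
  refine ⟨(t : ℝ)⁻¹ • ∑' k, X ^ k, fun i j => mul_nonneg (inv_nonneg.2 t.2) ?_, hR,
    mul_eq_one_comm.1 hR⟩
  have hcl : IsClosed {M : Matrix (Fin m) (Fin m) ℝ | 0 ≤ M i j} :=
    isClosed_le continuous_const (continuous_id.matrix_elem i j)
  exact hcl.mem_of_tendsto hs.hasSum (Eventually.of_forall fun s => by
    simp only [Set.mem_ofPred_eq, Matrix.sum_apply]
    exact Finset.sum_nonneg fun k _ => hpow k i j)

/-- Applying the resolvent to the all-ones vector gives `w ≥ 0` with `t w - C w = 1`; hence `t w ≥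
1`, which forces `w > 0`. -/
lemma exists_pos_mulVec_lt {C : Matrix (Fin m) (Fin m) ℝ} (hC : ∀ i j, 0 ≤ C i j) {t : ℝ≥0}
    (ht : radius C < t) : ∃ w : Fin m → ℝ, (∀ i, 0 < w i) ∧ ∀ i, (C *ᵥ w) i < t * w i := by
  obtain ⟨R, hR, hCR, -⟩ := exists_nonneg_resolvent hC ht
  obtain ⟨w, hw⟩ : ∃ w : Fin m → ℝ, w = R *ᵥ 1 := ⟨_, rfl⟩
  have h : ∀ i, t * w i - (C *ᵥ w) i = 1 := by
    intro i
    have := congrFun (congrArg (· *ᵥ (1 : Fin m → ℝ)) hCR) i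
    simpa [← Matrix.mulVec_mulVec, Matrix.sub_mulVec, Matrix.smul_mulVec, ← hw] using this
  have hnn : ∀ i, 0 ≤ w i := hw ▸ mulVec_nonneg hR fun _ => zero_le_one
  refine ⟨w, fun i => ?_, fun i => by linarith [h i]⟩
  have h1 := mulVec_nonneg hC hnn i
  have h2 : 0 < t * w i := by linarith [h i]
  exact pos_of_mul_pos_right h2 t.2

/-- The spectral radius is at most `t` as soon as some positive vector satisfies `C z ≤ t z`. -/
lemma radius_le_of_mulVec_le {C : Matrix (Fin m) (Fin m) ℝ} (hC : ∀ i j, 0 ≤ C i j) {t : ℝ≥0}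
    {z : Fin m → ℝ} (hz : ∀ i, 0 < z i) (h : C *ᵥ z ≤ (t : ℝ) • z) : radius C ≤ t := by
  refine iSup₂_le fun c hc => ?_
  obtain ⟨v, hv0, hv⟩ := exists_eigenvector_of_mem_spectrum hc
  obtain ⟨i₁, hi₁⟩ := Function.ne_iff.1 hv0
  -- The least multiple `a z` dominating `|v|` touches it at `i`; the eigenvalue is compared there.
  obtain ⟨i, -, hi⟩ := Finset.exists_max_image Finset.univ (fun i => ‖v i‖ / z i)
    ⟨i₁, Finset.mem_univ _⟩
  set a := ‖v i‖ / z i with ha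
  have hle : ∀ j, ‖v j‖ ≤ a * z j := fun j =>
    (div_le_iff₀ (hz j)).1 (hi j (Finset.mem_univ j))
  have ha0 : 0 < a := by
    by_contra hcon
    have := hle i₁
    have h2 : 0 < ‖v i₁‖ := norm_pos_iff.2 hi₁
    nlinarith [hz i₁, mul_nonneg (sub_nonneg.2 (not_lt.1 hcon)) (hz i₁).le]
  have hvi : ‖v i‖ = a * z i := by rw [ha, div_mul_cancel₀ _ (hz i).ne']
  have h1 := norm_mul_le_mulVec_norm hC hv i
  have h2 : (C *ᵥ fun j => ‖v j‖) i ≤ a * (C *ᵥ z) i := by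
    refine (mulVec_le_mulVec hC (y := a • z) hle i).trans_eq ?_
    rw [Matrix.mulVec_smul, Pi.smul_apply, smul_eq_mul]
  have h3 : (C *ᵥ z) i ≤ t * z i := h i
  have h4 : ‖c‖ * (a * z i) ≤ t * (a * z i) := by
    rw [hvi] at h1
    nlinarith [mul_le_mul_of_nonneg_left h3 ha0.le]
  have h5 : ‖c‖ ≤ t := le_of_mul_le_mul_right h4 (mul_pos ha0 (hz i))
  exact_mod_cast h5

/-- The Perron-Frobenius theorem: the spectral radius of a nonnegative matrix is an eigenvalue
with a nonnegative eigenvector. -/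
theorem exists_perron_vector (hm : 0 < m) {C : Matrix (Fin m) (Fin m) ℝ}
    (hC : ∀ i j, 0 ≤ C i j) :
    ∃ y ∈ stdSimplex ℝ (Fin m), C *ᵥ y = (radius C).toReal • y := by
  have : Nonempty (Fin m) := ⟨⟨0, hm⟩⟩
  obtain ⟨c, hc, hcr⟩ := spectrum.exists_nnnorm_eq_spectralRadius (C.map (algebraMap ℝ ℂ))
  obtain ⟨v, hv0, hv⟩ := exists_eigenvector_of_mem_spectrum hc
  have hrad : radius C = (‖c‖₊ : ℝ≥0∞) := hcr.symm
  have hρ : (radius C).toReal = ‖c‖ := by simp [hrad]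
  rw [hρ]
  set u : Fin m → ℝ := fun j => ‖v j‖ with hu
  have hCu : ∀ i, ‖c‖ * u i ≤ (C *ᵥ u) i := norm_mul_le_mulVec_norm hC hv
  have hu0 : ∀ i, 0 ≤ u i := fun i => norm_nonneg _
  have hsu : 0 < ∑ i, u i := by
    obtain ⟨i, hi⟩ := Function.ne_iff.1 hv0
    exact Finset.sum_pos' (fun i _ => hu0 i) ⟨i, Finset.mem_univ i, norm_pos_iff.2 hi⟩
  -- With `t = ‖c‖ + 1/(k+1)` and resolvent `R`, take `x = R u`. Since `(t - C) u ≤ u/(k+1)`,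
  -- applying `R` gives `x ≥ (k+1) u`. The mass of `x` thus blows up, and after normalization the
  -- defect `u` vanishes in the limit.
  have key : ∀ k : ℕ, ∃ x : Fin m → ℝ, (∀ i, 0 ≤ x i) ∧
      (k + 1) * ∑ i, u i ≤ ∑ i, x i ∧ C *ᵥ x = (‖c‖ + 1 / ((k : ℝ) + 1)) • x - u := by
    intro k
    obtain ⟨R, hR, hCR, hRC⟩ := exists_nonneg_resolvent hC (t := ‖c‖₊ + 1 / ((k : ℝ≥0) + 1))
      (by rw [hrad]; exact_mod_cast lt_add_of_pos_right _ (by positivity))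
    simp only [NNReal.coe_add, NNReal.coe_div, NNReal.coe_one, NNReal.coe_natCast,
      coe_nnnorm] at hCR hRC
    refine ⟨R *ᵥ u, mulVec_nonneg hR hu0, ?_, ?_⟩
    · rw [Finset.mul_sum]
      refine Finset.sum_le_sum fun i _ => ?_
      have h1 := congrFun (congrArg (· *ᵥ u) hRC) i
      simp only [← Matrix.mulVec_mulVec, Matrix.one_mulVec] at h1
      have h2 : (R *ᵥ (((‖c‖ + 1 / ((k : ℝ) + 1)) • (1 : Matrix (Fin m) (Fin m) ℝ) - C) *ᵥ u)) i
          ≤ 1 / ((k : ℝ) + 1) * (R *ᵥ u) i := by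
        refine (mulVec_le_mulVec hR (y := (1 / ((k : ℝ) + 1)) • u) (fun j => ?_) i).trans_eq ?_
        · rw [Matrix.sub_mulVec, Matrix.smul_mulVec, Matrix.one_mulVec]
          simp only [Pi.sub_apply, Pi.smul_apply, smul_eq_mul]
          linarith [hCu j]
        · rw [Matrix.mulVec_smul, Pi.smul_apply, smul_eq_mul]
      rw [h1] at h2
      rw [one_div, inv_mul_eq_div, le_div_iff₀ (by positivity)] at h2
      linarith
    · have h1 := congrArg (· *ᵥ u) hCR
      simp only [← Matrix.mulVec_mulVec, Matrix.one_mulVec, Matrix.sub_mulVec,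
        Matrix.smul_mulVec] at h1
      rw [eq_sub_iff_add_eq, ← sub_eq_iff_eq_add'.1 h1]
  choose x hx0 hxs hCx using key
  have hpos : ∀ k, 0 < ∑ i, x k i := fun k =>
    (mul_pos (by positivity) hsu).trans_le (hxs k)
  let y : ℕ → Fin m → ℝ := fun k => (∑ i, x k i)⁻¹ • x k
  have hy : ∀ k, y k ∈ stdSimplex ℝ (Fin m) := fun k =>
    ⟨fun i => mul_nonneg (inv_nonneg.2 (hpos k).le) (hx0 k i), by
      simp only [y, Pi.smul_apply, smul_eq_mul, ← Finset.mul_sum]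
      exact inv_mul_cancel₀ (hpos k).ne'⟩
  obtain ⟨a, ha, φ, hφ, hlim⟩ := (isCompact_stdSimplex ℝ (Fin m)).tendsto_subseq hy
  refine ⟨a, ha, ?_⟩
  have hcont : Continuous fun z : Fin m → ℝ => C *ᵥ z := by fun_prop
  have hleft := (hcont.tendsto a).comp hlim
  have hinv : Tendsto (fun k => (∑ i, x k i)⁻¹) atTop (𝓝 0) :=
    tendsto_inv_atTop_zero.comp (tendsto_atTop_mono hxs
      ((tendsto_atTop_add_const_right _ _ tendsto_natCast_atTop_atTop).atTop_mul_const hsu))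
  have hright : Tendsto (fun k => (‖c‖ + 1 / ((φ k : ℝ) + 1)) • y (φ k)
      - (∑ i, x (φ k) i)⁻¹ • u) atTop (𝓝 ((‖c‖ + 0) • a - (0 : ℝ) • u)) :=
    ((tendsto_const_nhds.add (tendsto_one_div_add_atTop_nhds_zero_nat.comp
      hφ.tendsto_atTop)).smul hlim).sub ((hinv.comp hφ.tendsto_atTop).smul tendsto_const_nhds)
  have heq : ∀ k, C *ᵥ y (φ k) = (‖c‖ + 1 / ((φ k : ℝ) + 1)) • y (φ k)
      - (∑ i, x (φ k) i)⁻¹ • u := by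
    intro k
    simp only [y]
    rw [Matrix.mulVec_smul, hCx, smul_sub, smul_comm]
  have := tendsto_nhds_unique hleft (hright.congr fun k => (heq k).symm)
  simpa using this

/-- A nonzero nonnegative subinvariant vector of an irreducible matrix is positive. -/
lemma pos_of_isIrred {C : Matrix (Fin m) (Fin m) ℝ} (hirr : IsIrred C)
    (hC : ∀ i j, 0 ≤ C i j) {t : ℝ} {z : Fin m → ℝ} (hz : ∀ i, 0 ≤ z i) (hz0 : z ≠ 0)
    (h : C *ᵥ z ≤ t • z) (i : Fin m) : 0 < z i := by
  let := C.toQuiver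
  -- The zero set of `z` is closed under edges: where `z i = 0`, the nonnegative terms of row `i` of
  -- `C z` sum to zero.
  have hstep : ∀ i j, 0 < C i j → z i = 0 → z j = 0 := by
    intro i j hij hzi
    have h1 := h i
    rw [Pi.smul_apply, hzi, smul_zero] at h1
    rw [Matrix.mulVec, dotProduct] at h1
    have h2 := (Finset.sum_eq_zero_iff_of_nonneg
      (fun l _ => mul_nonneg (hC i l) (hz l))).1
      (le_antisymm h1 (Finset.sum_nonneg fun l _ => mul_nonneg (hC i l) (hz l)))
    exact (mul_eq_zero.1 (h2 j (Finset.mem_univ j))).resolve_left hij.ne'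
  refine (hz i).lt_of_ne' fun hzi => hz0 (funext fun j => ?_)
  obtain ⟨p⟩ : Nonempty (Quiver.Path i j) := hirr i j
  induction p with
  | nil => exact hzi
  | cons p e ih => exact hstep _ _ e.down ih

end PerronFrobenius

/-! ### Column submatrices and monomial matrices -/

section Columns

lemma mulVec_extend (F : Matrix (Fin m) (Fin n) ℝ) (K : Finset (Fin n)) (hK : K.card = m)
    (w : Fin m → ℝ) :
    F *ᵥ Function.extend (K.orderEmbOfFin hK) w 0 = columns F K hK *ᵥ w := by
  ext i
  rw [Matrix.mulVec, dotProduct, Matrix.mulVec, dotProduct]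
  refine (Fintype.sum_of_injective _ (K.orderEmbOfFin hK).injective _ _ (fun j hj => ?_)
    fun l => ?_).symm
  · rw [Function.extend_apply' _ _ _ hj, Pi.zero_apply, mul_zero]
  · rw [(K.orderEmbOfFin hK).injective.extend_apply]
    rfl

lemma extend_comp_of_support_subset {K : Finset (Fin n)} (hK : K.card = m) {z : Fin n → ℝ}
    (hz : Function.support z ⊆ K) :
    Function.extend (K.orderEmbOfFin hK) (z ∘ K.orderEmbOfFin hK) 0 = z := by
  ext j
  by_cases hj : j ∈ K
  · obtain ⟨l, rfl⟩ : j ∈ Set.range (K.orderEmbOfFin hK) := by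
      rwa [Finset.range_orderEmbOfFin, Finset.mem_coe]
    rw [(K.orderEmbOfFin hK).injective.extend_apply, Function.comp_apply]
  · rw [Function.extend_apply' _ _ _ fun ⟨l, hl⟩ => hj (hl ▸ K.orderEmbOfFin_mem hK l),
      Pi.zero_apply]
    by_contra h
    exact hj (hz (Ne.symm h))

lemma support_extend_subset {K : Finset (Fin n)} (hK : K.card = m) (w : Fin m → ℝ) :
    Function.support (Function.extend (K.orderEmbOfFin hK) w 0) ⊆ K := by
  intro j hj
  by_contra h
  exact hj (Function.extend_apply' _ _ _ fun ⟨l, hl⟩ => h (hl ▸ K.orderEmbOfFin_mem hK l))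

lemma IsMonomial.mulVec_pos {M : Matrix (Fin m) (Fin m) ℝ} (hM : IsMonomial M)
    {w : Fin m → ℝ} (hw : ∀ i, 0 < w i) (i : Fin m) : 0 < (M *ᵥ w) i := by
  obtain ⟨σ, d, hd, rfl⟩ := hM
  rw [← Matrix.mulVec_mulVec, Matrix.permMatrix_mulVec, Function.comp_apply,
    Matrix.mulVec_diagonal]
  exact mul_pos (hd _) (hw _)

lemma IsMonomial.inv {M : Matrix (Fin m) (Fin m) ℝ} (hM : IsMonomial M) :
    M * M⁻¹ = 1 ∧ M⁻¹ * M = 1 ∧ ∀ i j, 0 ≤ M⁻¹ i j := by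
  obtain ⟨σ, d, hd, rfl⟩ := hM
  have h : σ.permMatrix ℝ * Matrix.diagonal d * (Matrix.diagonal d⁻¹ * σ⁻¹.permMatrix ℝ) = 1 := by
    rw [Matrix.mul_assoc, ← Matrix.mul_assoc (Matrix.diagonal d), Matrix.diagonal_mul_diagonal,
      show (fun i => d i * d⁻¹ i) = fun _ => 1 from
        funext fun i => mul_inv_cancel₀ (hd i).ne', Matrix.diagonal_one, Matrix.one_mul,
      ← Matrix.permMatrix_mul, inv_mul_cancel, Matrix.permMatrix_one]
  rw [Matrix.inv_eq_right_inv h]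
  refine ⟨h, mul_eq_one_comm.1 h, fun i j => ?_⟩
  rw [Matrix.diagonal_mul]
  refine mul_nonneg (inv_nonneg.2 (hd i).le) ?_
  rw [Equiv.Perm.permMatrix, PEquiv.toMatrix_apply]
  split_ifs <;> norm_num

variable {A B : Matrix (Fin m) (Fin n) ℝ} {K : Finset (Fin n)} {hK : K.card = m}

lemma columns_mul_reduced (hM : IsMonomial (columns B K hK)) :
    columns B K hK * reduced A B K hK = columns A K hK := by
  rw [reduced, ← Matrix.mul_assoc, hM.inv.1, Matrix.one_mul]

lemma reduced_nonneg (hA : ∀ i j, 0 ≤ A i j) (hM : IsMonomial (columns B K hK)) (i j : Fin m) :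
    0 ≤ reduced A B K hK i j := by
  rw [reduced, Matrix.mul_apply]
  exact Finset.sum_nonneg fun l _ => mul_nonneg (hM.inv.2.2 i l) (hA _ _)

lemma reduced_mulVec_le (hM : IsMonomial (columns B K hK)) {t : ℝ} {w : Fin m → ℝ}
    (h : columns A K hK *ᵥ w ≤ t • (columns B K hK *ᵥ w)) :
    reduced A B K hK *ᵥ w ≤ t • w := by
  intro i
  have h1 := mulVec_le_mulVec hM.inv.2.2 h i
  rwa [Matrix.mulVec_smul, Matrix.mulVec_mulVec, Matrix.mulVec_mulVec, hM.inv.2.1,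
    Matrix.one_mulVec] at h1

/-- A set of `m` columns of a WN-pair that meets every row gives a monomial submatrix. -/
lemma IsWNPair.isMonomial_columns (hAB : IsWNPair A B) (K : Finset (Fin n)) (hK : K.card = m)
    (h : ∀ i, ∃ j ∈ K, 0 < B i j) : IsMonomial (columns B K hK) := by
  -- `f j` is the row of the positive entry of column `j`. On the `m` columns in `K` it is onto the
  -- rows, hence a permutation.
  choose f hf huniq using hAB.column
  let e := K.orderEmbOfFin hK
  have hsurj : Function.Surjective (f ∘ e) := by
    intro i
    obtain ⟨j, hj, hij⟩ := h i
    obtain ⟨l, rfl⟩ : j ∈ Set.range (K.orderEmbOfFin hK) := by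
      rwa [Finset.range_orderEmbOfFin, Finset.mem_coe]
    exact ⟨l, (huniq _ i hij).symm⟩
  have hbij : Function.Bijective (f ∘ e) := Finite.injective_iff_bijective.1
    (Finite.injective_iff_surjective.2 hsurj)
  refine ⟨(Equiv.ofBijective _ hbij).symm, fun l => B (f (e l)) (e l), fun l => hf _, ?_⟩
  ext i l
  rw [Matrix.mul_diagonal, Equiv.Perm.permMatrix, PEquiv.toMatrix_apply, Equiv.toPEquiv_apply]
  simp only [Option.mem_some_iff]
  change B i (e l) = _
  by_cases hi : i = f (e l)
  · subst hi
    have hl : (Equiv.ofBijective _ hbij).symm (f (e l)) = l :=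
      (Equiv.ofBijective _ hbij).symm_apply_apply l
    rw [if_pos hl, one_mul]
  · rw [if_neg, zero_mul]
    · exact le_antisymm (not_lt.1 fun hpos => hi (huniq _ i hpos)) (hAB.nonneg_right _ _)
    · intro hl
      exact hi ((Equiv.symm_apply_eq _).1 hl)

lemma IsWNPair.exists_isMonomial (hAB : IsWNPair A B) :
    ∃ (K : Finset (Fin n)) (hK : K.card = m), IsMonomial (columns B K hK) := by
  choose g hg using hAB.row_ne_zero
  have hpos : ∀ i, 0 < B i (g i) := fun i => (hAB.nonneg_right _ _).lt_of_ne' (hg i)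
  have hinj : Function.Injective g := fun i i' h =>
    (hAB.column (g i)).unique (hpos i) (h ▸ hpos i')
  have hK : (Finset.univ.image g).card = m := by
    rw [Finset.card_image_of_injective _ hinj, Finset.card_univ, Fintype.card_fin]
  exact ⟨_, hK, hAB.isMonomial_columns _ hK fun i =>
    ⟨g i, Finset.mem_image_of_mem g (Finset.mem_univ i), hpos i⟩⟩

end Columns

/-! ### Carathéodory reduction -/

section Caratheodory

/-- A nonnegative solution of a linear system whose support has more elements than there are
equations can be replaced by a nonnegative solution with smaller support. -/
lemma exists_card_support_lt (G : Matrix (Fin m) (Fin n) ℝ) {z : Fin n → ℝ} (hz : ∀ j, 0 ≤ z j)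
    (hcard : m < (Finset.univ.filter fun j => z j ≠ 0).card) :
    ∃ z' : Fin n → ℝ, (∀ j, 0 ≤ z' j) ∧ G *ᵥ z' = G *ᵥ z ∧
      (Finset.univ.filter fun j => z' j ≠ 0).card
        < (Finset.univ.filter fun j => z j ≠ 0).card := by
  set S := Finset.univ.filter fun j => z j ≠ 0 with hS
  -- More than `m` columns are dependent; the sign of the relation is chosen to give a positive
  -- entry.
  obtain ⟨v, hvS, hGv, j₀, hj₀⟩ : ∃ v : Fin n → ℝ, (∀ j ∉ S, v j = 0) ∧ G *ᵥ v = 0 ∧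
      ∃ j, 0 < v j := by
    let L : (S → ℝ) →ₗ[ℝ] (Fin m → ℝ) :=
      G.mulVecLin ∘ₗ Function.ExtendByZero.linearMap ℝ ((↑) : S → Fin n)
    have hker : LinearMap.ker L ≠ ⊥ := LinearMap.ker_ne_bot_of_finrank_lt (by simpa using hcard)
    obtain ⟨u, hu, hu0⟩ := Submodule.exists_mem_ne_zero_of_ne_bot hker
    obtain ⟨s, hs⟩ := Function.ne_iff.1 hu0
    have hext : ∀ s : S, Function.extend ((↑) : S → Fin n) u 0 (s : Fin n) = u s := fun s =>
      Subtype.val_injective.extend_apply _ _ _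
    have hGu : G *ᵥ Function.extend ((↑) : S → Fin n) u 0 = 0 := hu
    have hout : ∀ j ∉ S, Function.extend ((↑) : S → Fin n) u 0 j = 0 := fun j hj =>
      Function.extend_apply' _ _ _ fun ⟨a, ha⟩ => hj (ha ▸ a.2)
    rcases lt_or_gt_of_ne hs with hneg | hpos
    · exact ⟨-Function.extend ((↑) : S → Fin n) u 0, fun j hj => by simp [hout j hj],
        by rw [Matrix.mulVec_neg, hGu, neg_zero], s, by
          rw [Pi.neg_apply, hext]; exact neg_pos.2 hneg⟩
    · exact ⟨_, hout, hGu, s, by rw [hext]; exact hpos⟩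
  -- The minimal ratio is the largest multiple of `v` that can be subtracted while staying
  -- nonnegative; it kills entry `p`.
  obtain ⟨p, hp, hmin⟩ := Finset.exists_min_image (Finset.univ.filter fun j => 0 < v j)
    (fun j => z j / v j) ⟨j₀, by simpa using hj₀⟩
  replace hp : 0 < v p := by simpa using hp
  have hpS : p ∈ S := by
    by_contra h
    exact hp.ne' (hvS p h)
  have hc : 0 ≤ z p / v p := div_nonneg (hz p) hp.le
  refine ⟨z - (z p / v p) • v, fun j => ?_, ?_, Finset.card_lt_card
    ((Finset.ssubset_iff_of_subset fun j hj => ?_).2 ⟨p, hpS, ?_⟩)⟩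
  · rw [Pi.sub_apply, Pi.smul_apply, smul_eq_mul, sub_nonneg]
    rcases lt_or_ge 0 (v j) with hj | hj
    · exact (le_div_iff₀ hj).1 (hmin j (by simpa using hj))
    · exact (mul_nonpos_of_nonneg_of_nonpos hc hj).trans (hz j)
  · rw [Matrix.mulVec_sub, Matrix.mulVec_smul, hGv, smul_zero, sub_zero]
  · by_contra h
    have h1 : z j = 0 := by simpa [hS] using h
    simp [h1, hvS j h] at hj
  · simp [div_mul_cancel₀ _ hp.ne']

/-- Carathéodory's theorem for cones. -/
lemma exists_nonneg_solution_card_le (G : Matrix (Fin m) (Fin n) ℝ) {z : Fin n → ℝ}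
    (hz : ∀ j, 0 ≤ z j) : ∃ z' : Fin n → ℝ, (∀ j, 0 ≤ z' j) ∧ G *ᵥ z' = G *ᵥ z ∧
      (Finset.univ.filter fun j => z' j ≠ 0).card ≤ m := by
  induction h : (Finset.univ.filter fun j => z j ≠ 0).card using Nat.strong_induction_on
    generalizing z with
  | _ k ih =>
    rcases le_or_gt k m with hk | hk
    · exact ⟨z, hz, rfl, h.trans_le hk⟩
    · obtain ⟨z₁, hz₁, hG₁, hcard⟩ := exists_card_support_lt G hz (h ▸ hk)
      obtain ⟨z₂, hz₂, hG₂, h₂⟩ := ih _ (h ▸ hcard) hz₁ rfl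
      exact ⟨z₂, hz₂, hG₂.trans hG₁, h₂⟩

end Caratheodory

/-! ### The Collatz–Wielandt quotient and optimal vectors -/

section Quotient

variable {A B : Matrix (Fin m) (Fin n) ℝ}

lemma ratio_le {x : Fin n → ℝ} {t : ℝ≥0} (h : A *ᵥ x ≤ (t : ℝ) • (B *ᵥ x)) :
    ratio A B x ≤ t := iInf₂_le t h

lemma exists_of_ratio_lt {x : Fin n → ℝ} {s : ℝ≥0∞} (h : ratio A B x < s) :
    ∃ t : ℝ≥0, (t : ℝ≥0∞) < s ∧ A *ᵥ x ≤ (t : ℝ) • (B *ᵥ x) := by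
  simp only [ratio, iInf_lt_iff] at h
  obtain ⟨t, ht, hts⟩ := h
  exact ⟨t, hts, ht⟩

lemma quotient_le_ratio {x : Fin n → ℝ} (hx : ∀ j, 0 < x j) : quotient A B ≤ ratio A B x :=
  iInf₂_le x hx

lemma exists_of_quotient_lt {s : ℝ≥0∞} (h : quotient A B < s) :
    ∃ (x : Fin n → ℝ) (t : ℝ≥0), (∀ j, 0 < x j) ∧ (t : ℝ≥0∞) < s ∧
      A *ᵥ x ≤ (t : ℝ) • (B *ᵥ x) := by
  simp only [quotient, iInf_lt_iff] at h
  obtain ⟨x, hx, hxs⟩ := h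
  obtain ⟨t, hts, ht⟩ := exists_of_ratio_lt hxs
  exact ⟨x, t, hx, hts, ht⟩

/-- A finite infimum in the definition of `ratio` is attained. -/
lemma mulVec_le_ratio_smul (hB : ∀ i j, 0 ≤ B i j) {x : Fin n → ℝ} (hx : ∀ j, 0 ≤ x j)
    (h : ratio A B x ≠ ∞) : A *ᵥ x ≤ (ratio A B x).toReal • (B *ᵥ x) := by
  intro i
  rw [Pi.smul_apply, smul_eq_mul]
  have hlim : Tendsto (fun s : ℝ => s * (B *ᵥ x) i) (𝓝[>] (ratio A B x).toReal)
      (𝓝 ((ratio A B x).toReal * (B *ᵥ x) i)) :=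
    ((continuous_id.mul continuous_const).tendsto _).mono_left nhdsWithin_le_nhds
  refine ge_of_tendsto hlim (eventually_nhdsWithin_of_forall fun s hs => ?_)
  have hs0 : 0 ≤ s := ENNReal.toReal_nonneg.trans (le_of_lt hs)
  obtain ⟨t, hts, ht⟩ := exists_of_ratio_lt (s := ENNReal.ofReal s)
    ((ENNReal.lt_ofReal_iff_toReal_lt h).2 hs)
  have hts' : (t : ℝ) ≤ s := by
    rw [← ENNReal.ofReal_coe_nnreal] at hts
    exact ((ENNReal.ofReal_lt_ofReal_iff_of_nonneg t.coe_nonneg).1 hts).le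
  exact (ht i).trans (mul_le_mul_of_nonneg_right hts' (mulVec_nonneg hB hx i))

/-- Since no column of `B` vanishes, `B y` is positive in some row, and equality there rules out a
smaller `t`. -/
lemma IsGPFVector.ratio_eq (hB : ∀ i j, 0 ≤ B i j) (hcol : ∀ j, ∃ i, 0 < B i j)
    {y : Fin n → ℝ} (hy : IsGPFVector A B y) : ratio A B y = quotient A B := by
  refine le_antisymm ?_ (le_iInf₂ fun t ht => ?_)
  · rw [← ENNReal.coe_toNNReal hy.finite]
    exact ratio_le hy.eigen.le
  · obtain ⟨j, hj⟩ := Function.ne_iff.1 hy.ne_zero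
    obtain ⟨i, hi⟩ := hcol j
    have hpos : 0 < (B *ᵥ y) i := by
      rw [Matrix.mulVec, dotProduct]
      exact Finset.sum_pos' (fun l _ => mul_nonneg (hB i l) (hy.nonneg l))
        ⟨j, Finset.mem_univ j, mul_pos hi ((hy.nonneg j).lt_of_ne' hj)⟩
    have h1 := ht i
    rw [hy.eigen] at h1
    have h2 : (quotient A B).toReal ≤ t := le_of_mul_le_mul_right h1 hpos
    rw [← ENNReal.ofReal_toReal hy.finite, ← ENNReal.ofReal_coe_nnreal]
    exact ENNReal.ofReal_le_ofReal h2

/-- Every generalized Perron-Frobenius vector is optimal: it is approximated by adding small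
multiples of nearly optimal positive vectors. -/
theorem IsGPFVector.isOptimal (hB : ∀ i j, 0 ≤ B i j) (hcol : ∀ j, ∃ i, 0 < B i j)
    {y : Fin n → ℝ} (hy : IsGPFVector A B y) : IsOptimal A B y := by
  have key : ∀ k : ℕ, ∃ u : Fin n → ℝ, (∀ j, 0 < u j) ∧
      (∀ j, |u j - y j| ≤ 1 / ((k : ℝ) + 1)) ∧
      ratio A B u ≤ quotient A B + ENNReal.ofReal (1 / ((k : ℝ) + 1)) := by
    intro k
    have hη : (0 : ℝ) < 1 / ((k : ℝ) + 1) := by positivity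
    obtain ⟨x, t, hx, hts, ht⟩ := exists_of_quotient_lt (A := A) (B := B)
      (ENNReal.lt_add_right hy.finite (ENNReal.ofReal_pos.2 hη).ne')
    -- Chosen so that `δ ‖x‖ ≤ 1/(k+1)`.
    set δ : ℝ := 1 / ((k : ℝ) + 1) / (1 + ‖x‖) with hδ
    have hδ0 : 0 < δ := by positivity
    refine ⟨y + δ • x, fun j => add_pos_of_nonneg_of_pos (hy.nonneg j) (mul_pos hδ0 (hx j)),
      fun j => ?_, ?_⟩
    · rw [Pi.add_apply, add_sub_cancel_left, Pi.smul_apply, smul_eq_mul, abs_mul,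
        abs_of_pos hδ0, hδ, div_mul_eq_mul_div, div_le_iff₀ (by positivity)]
      refine mul_le_mul_of_nonneg_left ?_ hη.le
      have := norm_le_pi_norm x j
      rw [Real.norm_eq_abs] at this
      linarith
    -- Both `y` and `x` satisfy `A v ≤ T B v` for the maximum `T`, hence so does `y + δ x`.
    · have hle : ((max t (quotient A B).toNNReal : ℝ≥0) : ℝ≥0∞)
          ≤ quotient A B + ENNReal.ofReal (1 / ((k : ℝ) + 1)) := by
        rw [ENNReal.coe_max, ENNReal.coe_toNNReal hy.finite]
        exact max_le hts.le le_self_add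
      refine (ratio_le fun i => ?_).trans hle
      rw [Matrix.mulVec_add, Matrix.mulVec_add, Matrix.mulVec_smul, Matrix.mulVec_smul,
        hy.eigen]
      have h1 := ht i
      have hBy := mulVec_nonneg hB hy.nonneg i
      have hBx := mulVec_nonneg hB (fun j => (hx j).le) i
      simp only [Pi.add_apply, Pi.smul_apply, smul_eq_mul, mul_add] at h1 ⊢
      have h2 : (quotient A B).toReal ≤ (max t (quotient A B).toNNReal : ℝ≥0) :=
        NNReal.coe_le_coe.2 (le_max_right _ _)
      have h3 : (t : ℝ) ≤ (max t (quotient A B).toNNReal : ℝ≥0) :=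
        NNReal.coe_le_coe.2 (le_max_left _ _)
      refine add_le_add (mul_le_mul_of_nonneg_right h2 hBy) ?_
      rw [mul_left_comm]
      exact mul_le_mul_of_nonneg_left (h1.trans (mul_le_mul_of_nonneg_right h3 hBx)) hδ0.le
  choose u hu hclose hratio using key
  refine ⟨hy.nonneg, hy.ne_zero, hy.ratio_eq hB hcol, u, hu, tendsto_pi_nhds.2 fun j => ?_, ?_⟩
  · exact tendsto_iff_norm_sub_tendsto_zero.2 (squeeze_zero (fun k => norm_nonneg _)
      (fun k => hclose k j) tendsto_one_div_add_atTop_nhds_zero_nat)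
  · refine tendsto_of_tendsto_of_tendsto_of_le_of_le tendsto_const_nhds ?_
      (fun k => quotient_le_ratio (hu k)) hratio
    have h := ENNReal.tendsto_ofReal (tendsto_one_div_add_atTop_nhds_zero_nat (𝕜 := ℝ))
    simpa using tendsto_const_nhds (x := quotient A B) |>.add h

/-! ### The minimum over monomial submatrices -/

variable {K : Finset (Fin n)} {hK : K.card = m}

lemma IsWNPair.quotient_le_radius (hAB : IsWNPair A B) (hM : IsMonomial (columns B K hK)) :
    quotient A B ≤ radius (reduced A B K hK) := by
  refine ENNReal.le_of_forall_pos_le_add fun ε hε _ => ?_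
  have hfin := radius_ne_top (reduced A B K hK)
  set t : ℝ≥0 := (radius (reduced A B K hK)).toNNReal + ε with ht
  have hte : (t : ℝ≥0∞) = radius (reduced A B K hK) + ε := by
    rw [ht, ENNReal.coe_add, ENNReal.coe_toNNReal hfin]
  rw [← hte]
  obtain ⟨w, hw, hlt⟩ := exists_pos_mulVec_lt (reduced_nonneg hAB.nonneg_left hM)
    (t := t) (hte ▸ ENNReal.lt_add_right hfin (by simpa using hε.ne'))
  set y := Function.extend (K.orderEmbOfFin hK) w 0 with hy
  have hy0 : ∀ j, 0 ≤ y j := by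
    intro j
    by_cases hj : ∃ l, K.orderEmbOfFin hK l = j
    · obtain ⟨l, rfl⟩ := hj
      rw [hy, (K.orderEmbOfFin hK).injective.extend_apply]
      exact (hw l).le
    · rw [hy, Function.extend_apply' _ _ _ hj, Pi.zero_apply]
  have hstrict : ∀ i, (A *ᵥ y) i < t * (B *ᵥ y) i := by
    intro i
    have h1 := hM.mulVec_pos (w := (t : ℝ) • w - reduced A B K hK *ᵥ w)
      (fun i => sub_pos.2 (hlt i)) i
    rw [Matrix.mulVec_sub, Matrix.mulVec_smul, Matrix.mulVec_mulVec, columns_mul_reduced hM,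
      ← mulVec_extend, ← mulVec_extend] at h1
    exact sub_pos.1 h1
  -- The finitely many strict inequalities survive a small perturbation into the positive orthant.
  have hev : ∀ᶠ ε : ℝ in 𝓝[>] 0, ∀ i,
      (A *ᵥ (y + ε • 1)) i < t * (B *ᵥ (y + ε • 1)) i := by
    refine eventually_all.2 fun i => ?_
    refine nhdsWithin_le_nhds (ContinuousAt.eventually_lt ?_ ?_ ?_)
    · fun_prop
    · fun_prop
    · simpa using hstrict i
  obtain ⟨δ, hδ, hδ0⟩ := (hev.and self_mem_nhdsWithin).exists
  have hpos : ∀ j, 0 < (y + δ • (1 : Fin n → ℝ)) j := fun j =>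
    add_pos_of_nonneg_of_pos (hy0 j) (mul_pos hδ0 one_pos)
  exact (quotient_le_ratio hpos).trans (ratio_le fun i => (hδ i).le)

lemma IsWNPair.exists_radius_le (hAB : IsWNPair A B) {x : Fin n → ℝ} (hx : ∀ j, 0 < x j)
    {t t' : ℝ≥0} (htt : t < t') (h : A *ᵥ x ≤ (t : ℝ) • (B *ᵥ x)) :
    ∃ (K : Finset (Fin n)) (hK : K.card = m), IsMonomial (columns B K hK) ∧
      radius (reduced A B K hK) ≤ t' := by
  set G := (t' : ℝ) • B - A with hG
  have hGv : ∀ (v : Fin n → ℝ) i, (G *ᵥ v) i = t' * (B *ᵥ v) i - (A *ᵥ v) i := by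
    intro v i
    rw [hG, Matrix.sub_mulVec, Matrix.smul_mulVec]
    rfl
  have hBx : ∀ i, 0 < (B *ᵥ x) i := by
    intro i
    obtain ⟨j, hj⟩ := hAB.row_ne_zero i
    rw [Matrix.mulVec, dotProduct]
    exact Finset.sum_pos' (fun l _ => mul_nonneg (hAB.nonneg_right i l) (hx l).le)
      ⟨j, Finset.mem_univ j, mul_pos ((hAB.nonneg_right i j).lt_of_ne' hj) (hx j)⟩
  have hGx : ∀ i, 0 < (G *ᵥ x) i := by
    intro i
    rw [hGv]
    have h1 : (A *ᵥ x) i ≤ t * (B *ᵥ x) i := h i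
    have h2 : (t : ℝ) * (B *ᵥ x) i < t' * (B *ᵥ x) i :=
      mul_lt_mul_of_pos_right (NNReal.coe_lt_coe.2 htt) (hBx i)
    linarith
  obtain ⟨z, hz, hGz, hcard⟩ := exists_nonneg_solution_card_le G fun j => (hx j).le
  rw [← hGz] at hGx
  set K := Finset.univ.filter fun j => z j ≠ 0 with hKdef
  have hmeet : ∀ i, ∃ j ∈ K, 0 < B i j := by
    intro i
    have h1 : 0 < (B *ᵥ z) i := by
      have h2 := hGx i
      rw [hGv] at h2
      have h3 := mulVec_nonneg hAB.nonneg_left hz i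
      exact pos_of_mul_pos_right (a := (t' : ℝ)) (by linarith) t'.coe_nonneg
    rw [Matrix.mulVec, dotProduct] at h1
    obtain ⟨j, -, hj⟩ := Finset.exists_lt_of_sum_lt (s := Finset.univ) (f := fun _ => (0 : ℝ))
      (by simpa using h1)
    refine ⟨j, ?_, pos_of_mul_pos_left hj (hz j)⟩
    simpa [hKdef] using (right_ne_zero_of_mul hj.ne')
  -- At most `m` by Carathéodory; at least `m` because distinct rows need distinct columns.
  have hK : K.card = m := by
    refine le_antisymm hcard ?_
    choose g hgK hg using hmeet
    have hinj : Function.Injective g := fun i i' h =>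
      (hAB.column (g i)).unique (hg i) (h ▸ hg i')
    simpa using Finset.card_le_card_of_injOn (s := Finset.univ) g (fun i _ => hgK i) hinj.injOn
  have hM := hAB.isMonomial_columns K hK hmeet
  have hsupp : Function.support z ⊆ K := fun j hj => by simpa [hKdef] using hj
  refine ⟨K, hK, hM, radius_le_of_mulVec_le (z := z ∘ K.orderEmbOfFin hK)
    (reduced_nonneg hAB.nonneg_left hM) (fun l => ?_) (reduced_mulVec_le hM fun i => ?_)⟩
  · have hl := K.orderEmbOfFin_mem hK l
    exact (hz _).lt_of_ne' (Finset.mem_filter.1 hl).2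
  · rw [← mulVec_extend, ← mulVec_extend, extend_comp_of_support_subset hK hsupp]
    have h1 := hGx i
    rw [hGv] at h1
    rw [Pi.smul_apply, smul_eq_mul]
    linarith

theorem IsWNPair.isLeast_quotient (hAB : IsWNPair A B) :
    IsLeast {s : ℝ≥0∞ | ∃ (K : Finset (Fin n)) (hK : K.card = m),
      IsMonomial (columns B K hK) ∧ s = radius (reduced A B K hK)} (quotient A B) := by
  set S := {s : ℝ≥0∞ | ∃ (K : Finset (Fin n)) (hK : K.card = m),
      IsMonomial (columns B K hK) ∧ s = radius (reduced A B K hK)} with hS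
  have hlower : quotient A B ∈ lowerBounds S := by
    rintro s ⟨K, hK, hM, rfl⟩
    exact hAB.quotient_le_radius hM
  have hfin : S.Finite := by
    classical
    refine (Set.finite_range fun K : Finset (Fin n) =>
      if hK : K.card = m then radius (reduced A B K hK) else 0).subset ?_
    rintro s ⟨K, hK, hM, rfl⟩
    exact ⟨K, dif_pos hK⟩
  obtain ⟨K₀, hK₀, hM₀⟩ := hAB.exists_isMonomial
  have hne : S.Nonempty := ⟨_, K₀, hK₀, hM₀, rfl⟩
  obtain ⟨s, hs, hmin⟩ := hfin.exists_minimal hne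
  refine ⟨?_, hlower⟩
  have hsq : s ≤ quotient A B := by
    refine le_of_forall_gt fun r hr => ?_
    obtain ⟨t', hqt, htr⟩ := ENNReal.lt_iff_exists_nnreal_btwn.1 hr
    obtain ⟨x, t, hx, htt, ht⟩ := exists_of_quotient_lt hqt
    obtain ⟨K, hK, hM, hle⟩ := hAB.exists_radius_le hx (ENNReal.coe_lt_coe.1 htt) ht
    refine lt_of_le_of_lt ?_ htr
    have hmem : radius (reduced A B K hK) ∈ S := ⟨K, hK, hM, rfl⟩
    rcases le_total s (radius (reduced A B K hK)) with h | h
    · exact h.trans hle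
    · exact (hmin hmem h).trans hle
  rwa [le_antisymm (hlower hs) hsq]

theorem IsWNPair.exists_isGPFVector (hm : 0 < m) (hAB : IsWNPair A B)
    (hM : IsMonomial (columns B K hK)) (hq : quotient A B = radius (reduced A B K hK)) :
    ∃ y ∈ stdSimplex ℝ (Fin n), Function.support y ⊆ (K : Set (Fin n)) ∧
      IsGPFVector A B y := by
  obtain ⟨w, hw, hCw⟩ := exists_perron_vector hm (reduced_nonneg hAB.nonneg_left hM)
  set y := Function.extend (K.orderEmbOfFin hK) w 0 with hy
  have hinj := (K.orderEmbOfFin hK).injective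
  have hy0 : ∀ j, 0 ≤ y j := by
    intro j
    by_cases hj : ∃ l, K.orderEmbOfFin hK l = j
    · obtain ⟨l, rfl⟩ := hj
      rw [hy, hinj.extend_apply]
      exact hw.1 l
    · rw [hy, Function.extend_apply' _ _ _ hj, Pi.zero_apply]
  have hsum : ∑ j, y j = 1 := by
    rw [← hw.2]
    refine (Fintype.sum_of_injective _ hinj _ _ (fun j hj => ?_) fun l => ?_).symm
    · rw [hy, Function.extend_apply' _ _ _ hj, Pi.zero_apply]
    · rw [hy, hinj.extend_apply]
  refine ⟨y, ⟨hy0, hsum⟩, support_extend_subset hK w, hy0, ?_, ?_, ?_⟩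
  · intro h0
    simp [h0] at hsum
  · rw [hq]
    exact radius_ne_top _
  · rw [hq, mulVec_extend, mulVec_extend, ← columns_mul_reduced hM, ← Matrix.mulVec_mulVec, hCw,
      Matrix.mulVec_smul]

/-- If the reduced matrix on `K` is irreducible, an optimal vector supported in `K` has support
equal to `K`. -/
lemma IsWNPair.support_eq (hAB : IsWNPair A B) (hM : IsMonomial (columns B K hK))
    (hirr : IsIrred (reduced A B K hK)) (hfin : quotient A B ≠ ∞) {z : Fin n → ℝ}
    (hz : IsOptimal A B z) (hsupp : Function.support z ⊆ (K : Set (Fin n))) :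
    Function.support z = K := by
  refine hsupp.antisymm fun j hj => ?_
  obtain ⟨l, rfl⟩ : j ∈ Set.range (K.orderEmbOfFin hK) := by
    rwa [Finset.range_orderEmbOfFin]
  have hext := extend_comp_of_support_subset hK hsupp
  -- Optimality gives only `A z ≤ ρ B z`, but subinvariance suffices for irreducibility to force
  -- positivity on `K`.
  have hle := mulVec_le_ratio_smul (A := A) hAB.nonneg_right hz.nonneg (hz.ratio_eq ▸ hfin)
  rw [← hext, mulVec_extend, mulVec_extend] at hle
  refine (pos_of_isIrred hirr (reduced_nonneg hAB.nonneg_left hM)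
    (z := z ∘ K.orderEmbOfFin hK) (fun i => hz.nonneg _) (fun h0 => hz.ne_zero ?_)
    (reduced_mulVec_le hM hle) l).ne'
  rw [← hext, h0]
  ext j
  by_cases hj : ∃ l, K.orderEmbOfFin hK l = j
  · obtain ⟨l, rfl⟩ := hj
    rw [(K.orderEmbOfFin hK).injective.extend_apply]
    rfl
  · rw [Function.extend_apply' _ _ _ hj]

end Quotient

end CollatzWielandt

end

theorem mainTheorem5 {m n : ℕ} (hm : 0 < m) (A B : Matrix (Fin m) (Fin n) ℝ)
    (hAB : CollatzWielandt.IsWNPair A B) :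
    IsLeast {s : ℝ≥0∞ | ∃ (K : Finset (Fin n)) (hK : K.card = m),
        CollatzWielandt.IsMonomial (CollatzWielandt.columns B K hK) ∧
        s = CollatzWielandt.radius (CollatzWielandt.reduced A B K hK)}
      (CollatzWielandt.quotient A B) ∧
    (∀ (K : Finset (Fin n)) (hK : K.card = m),
      CollatzWielandt.IsMonomial (CollatzWielandt.columns B K hK) →
      CollatzWielandt.quotient A B
        = CollatzWielandt.radius (CollatzWielandt.reduced A B K hK) →
      ∃ y ∈ stdSimplex ℝ (Fin n), CollatzWielandt.IsOptimal A B y ∧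
        Function.support y ⊆ (K : Set (Fin n)) ∧ CollatzWielandt.IsGPFVector A B y) ∧
    (CollatzWielandt.IsSIrreducible A B →
      ∀ (K : Finset (Fin n)) (hK : K.card = m),
        CollatzWielandt.IsMonomial (CollatzWielandt.columns B K hK) →
        CollatzWielandt.quotient A B
          = CollatzWielandt.radius (CollatzWielandt.reduced A B K hK) →
        ∀ y ∈ stdSimplex ℝ (Fin n), CollatzWielandt.IsOptimal A B y →
          Function.support y ⊆ (K : Set (Fin n)) → CollatzWielandt.IsGPFVector A B y →
          CollatzWielandt.IsMinimalOptimal A B y) := by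
  refine ⟨hAB.isLeast_quotient, fun K hK hM hq => ?_, fun hS K hK hM _ y _ hy hsupp hgpf =>
    ⟨hy, fun ⟨z, hz, hzy⟩ => ?_⟩⟩
  · obtain ⟨y, hy, hsupp, hgpf⟩ := hAB.exists_isGPFVector hm hM hq
    exact ⟨y, hy, hgpf.isOptimal hAB.nonneg_right fun j => (hAB.column j).exists, hsupp, hgpf⟩
  -- Both supports equal `K`, so neither is strictly contained in the other.
  · have h1 := hAB.support_eq hM (hS K hK hM) hgpf.finite hy hsupp
    have h2 := hAB.support_eq hM (hS K hK hM) hgpf.finite hz (hzy.1.trans hsupp)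
    rw [h1, h2] at hzy
    exact hzy.2 subset_rfl
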